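/- Let $p$ be a prime and let $K_0/\mathbb{Q}_p$ be an extension of discretely valued fields, i.e. a (not necessarily finite) field extension together with a discrete valuation $\nu_p : K_0 \to \mathbb{Q}\cup\{\infty\}$ extending the $p$-adic valuation of $\mathbb{Q}_p$, normalised by $\nu_p(p)=1$. Let $\mathcal{O}_0=\{x\in K_0 : \nu_p(x)\ge 0\}$. Let $A$ be a finite-dimensional semisimple $K_0$-algebra. An $\mathcal{O}_0$-order in $A$ is an $\mathcal{O}_0$-subalgebra of $A$ which is free and finitely generated as an $\mathcal{O}_0$-module and spans $A$ over $K_0$. An $\mathcal{O}_0$-order $\Lambda$ is symmetric if there is a symmetric bilinear form $T:A\times A\to K_0$ with $T(ab,c)=T(a,bc)$ for all $a,b,c \in A$ and $\Lambda=\Lambda^\sharp:=\{a\in A : T(a,x)\in\mathcal{O}_0 \text{ for all } x\in\Lambda\}$. The defect of a symmetric $\mathcal{O}_0$-order $\Lambda$ in $A$ is defined as follows. Choose a finite extension $E_0/K_0$ such that $E_0\otimes_{K_0}A\cong\bigoplus_{i=1}^n E_0^{d_i\times d_i}$ is split, extend $\nu_p$ to a discrete valuation on $E_0$, and let $\mathcal{E}_0$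 be its valuation ring. Let $\operatorname{Tr}_i$ denote the trace on the $i$-th matrix summand. Then there are $u_1,\dots,u_n\in E_0^\times$ such that $\mathcal{E}_0\otimes_{\mathcal{O}_0}\Lambda$ is self-dual with respect to the form $(a,b)\mapsto\sum_{i=1}^n u_i\operatorname{Tr}_i(ab)$, and the defect of $\Lambda$ is $\max_{1\le i\le n}\{-\nu_p(u_i)\}$. Proposition. Let $\Gamma$ be a maximal $\mathcal{O}_0$-order in $A$ and let $\Lambda\subseteq\Gamma$ be a symmetric $\mathcal{O}_0$-order in $A$ of defect $d$. Then $\Gamma/\Lambda$ and $\mathcal{O}_0/p\mathcal{O}_0$ have finite length over $\mathcal{O}_0$ and $$\operatorname{length}_{\mathcal{O}_0}(\Gamma/\Lambda)\;\le\;\tfrac12\cdot e\cdot d\cdot\dim_{K_0}(A),\qquad e=\operatorname{length}_{\mathcal{O}_0}(\mathcal{O}_0/p\mathcal{O}_0).$$ -/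

import Mathlib

open scoped TensorProduct

namespace SymmetricOrder

universe u w

section Valuations

variable {K : Type u} [Field K]

/-- The (exponential, additively written) valuation `v : K → ℚ ∪ {∞}` is discrete: its value
group is generated by one positive element, the value of a uniformizer `ϖ`. -/
def IsDiscrete (v : AddValuation K (WithTop ℚ)) : Prop :=
  ∃ ϖ : K, ϖ ≠ 0 ∧ 0 < v ϖ ∧ ∀ x : K, x ≠ 0 → ∃ n : ℤ, v x = v (ϖ ^ n)

/-- `K / ℚ_p`, with the valuation `v` on `K`, is an extension of discretely valued fields: `v` is
discrete and restricts to the usual valuation `ν_p` of `ℚ_p`, normalised by `ν_p(p) = 1`. -/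
structure IsDiscretelyValuedExtension (p : ℕ) [Fact p.Prime] [Algebra ℚ_[p] K]
    (v : AddValuation K (WithTop ℚ)) : Prop where
  discrete : IsDiscrete v
  extends_padic : ∀ x : ℚ_[p], x ≠ 0 →
    v (algebraMap ℚ_[p] K x) = (((x.valuation : ℤ) : ℚ) : WithTop ℚ)

/-- The valuation ring `{x | v x ≥ 0}`. -/
def ringOfIntegers (v : AddValuation K (WithTop ℚ)) : Subring K where
  carrier := {x | 0 ≤ v x}
  mul_mem' {a b} ha hb := by
    change 0 ≤ v (a * b)
    rw [v.map_mul]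
    exact add_nonneg ha hb
  one_mem' := by simp
  add_mem' {a b} ha hb := v.map_le_add ha hb
  zero_mem' := by simp
  neg_mem' {a} ha := by simpa [v.map_neg] using ha

end Valuations

section Orders

variable {K : Type u} [Field K] {A : Type w} [Ring A] [Algebra K A] {O : Subring K}

/-- `Λ` is an `O`-order in the `K`-algebra `A`: an `O`-subalgebra which is free and finitely
generated as an `O`-module and spans `A` over `K`. -/
structure IsOrder (Λ : Subalgebra O A) : Prop where
  free : Module.Free O Λ
  finite : Module.Finite O Λ
  span_eq_top : Submodule.span K (Λ : Set A) = ⊤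

/-- `Γ` is a maximal `O`-order in `A`. -/
def IsMaximalOrder (Γ : Subalgebra O A) : Prop :=
  Maximal (fun Δ : Subalgebra O A => IsOrder Δ) Γ

/-- `Λ` is self-dual with respect to `T`: it equals
`Λ^♯ = {a ∈ A | T(a, x) ∈ O for all x ∈ Λ}`. -/
def IsSelfDual (T : LinearMap.BilinForm K A) (Λ : Subalgebra O A) : Prop :=
  ∀ a : A, a ∈ Λ ↔ ∀ x ∈ Λ, T a x ∈ O

/-- `Λ` is a symmetric `O`-order in `A`: an order which is self-dual with respect to a
symmetric, associative bilinear form `T : A × A → K` (a symmetrising form for `Λ`). -/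
def IsSymmetricOrder (Λ : Subalgebra O A) : Prop :=
  IsOrder Λ ∧ ∃ T : LinearMap.BilinForm K A,
    (∀ a b : A, T a b = T b a) ∧ (∀ a b c : A, T (a * b) c = T a (b * c)) ∧ IsSelfDual T Λ

end Orders

section Defect

/-- For a split semisimple algebra `φ : B ≃ ⨁ᵢ F^{mᵢ × mᵢ}` and weights `uᵢ ∈ F`, the form
`T(a, b) = ∑ᵢ uᵢ · Trᵢ(a b)`, where `Trᵢ` is the trace on the `i`-th matrix summand. -/
noncomputable def weightedTraceForm {F : Type*} [Field F] {B : Type*} [Ring B] [Algebra F B]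
    {n : ℕ} {m : Fin n → ℕ} (φ : B ≃ₐ[F] ((i : Fin n) → Matrix (Fin (m i)) (Fin (m i)) F))
    (u : Fin n → F) : LinearMap.BilinForm F B :=
  LinearMap.mk₂ F (fun a b => ∑ i, u i * (φ (a * b) i).trace)
    (fun a a' b => by simp [add_mul, mul_add, Finset.sum_add_distrib])
    (fun c a b => by simp [Finset.mul_sum, mul_left_comm])
    (fun a b b' => by simp [mul_add, Finset.sum_add_distrib])
    (fun c a b => by simp [Finset.mul_sum, mul_left_comm])

/-- `d` is the defect of the order `Λ` in a split semisimple `F`-algebra `B`, `F` with discrete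
valuation `w`: `B ≅ ⨁ᵢ F^{mᵢ × mᵢ}`, and `Λ` is self-dual with respect to
`T(a, b) = ∑ᵢ uᵢ · Trᵢ(a b)` for some `uᵢ ∈ F^×` with `d = maxᵢ (- w(uᵢ))`. -/
def IsSplitDefect {F : Type*} [Field F] {B : Type*} [Ring B] [Algebra F B]
    (w : AddValuation F (WithTop ℚ)) (Λ : Subalgebra (ringOfIntegers w) B) (d : ℚ) : Prop :=
  ∃ (n : ℕ) (m : Fin n → ℕ) (φ : B ≃ₐ[F] ((i : Fin n) → Matrix (Fin (m i)) (Fin (m i)) F))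
    (u : Fin n → F),
    (∀ i, 0 < m i) ∧ (∀ i, u i ≠ 0) ∧ IsSelfDual (weightedTraceForm φ u) Λ ∧
      IsGreatest {x : ℚ | ∃ i, w (u i) = ((-x : ℚ) : WithTop ℚ)} d

/-- The `R`-subalgebra of an `F`-algebra `B` generated by `S`, for a subring `R` of `F`. -/
def generatedSubalgebra {F : Type*} [Field F] {B : Type*} [Ring B] [Algebra F B] (R : Subring F)
    (S : Set B) : Subalgebra R B :=
  Algebra.adjoin R S

/-- `d` is the defect of the symmetric order `Λ` in the semisimple `K`-algebra `A`: it is the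
defect of `𝓔 ⊗_O Λ` in the split algebra `E ⊗_K A`, for a finite extension `E` of `K` which
splits `A`, with a discrete valuation `w` extending `v` and valuation ring `𝓔`. The order
`𝓔 ⊗_O Λ` is the `𝓔`-subalgebra of `E ⊗_K A` generated by all `1 ⊗ x` with `x ∈ Λ`. -/
def IsDefect {K : Type u} [Field K] (v : AddValuation K (WithTop ℚ)) {A : Type w} [Ring A]
    [Algebra K A] (Λ : Subalgebra (ringOfIntegers v) A) (d : ℚ) : Prop :=
  ∃ (E : Type u) (_ : Field E) (_ : Algebra K E) (w : AddValuation E (WithTop ℚ)),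
    FiniteDimensional K E ∧ IsDiscrete w ∧ (∀ x : K, w (algebraMap K E x) = v x) ∧
      IsSplitDefect w (generatedSubalgebra (ringOfIntegers w)
        ((fun x : A => (1 : E) ⊗ₜ[K] x) '' (Λ : Set A))) d

end Defect

end SymmetricOrder

/-!
Elements of an order are integral, and the trace of an integral matrix is integral. Hence, after
extending scalars to a splitting field, every entry of the Gram matrix of a basis of `Γ` with
respect to `∑ᵢ uᵢ Trᵢ` has valuation at least `-d`, and its determinant has valuation at least
`-d · dim A`. Self-duality of `Λ` makes the inverse of the Gram matrix of a basis of `Λ` integral,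
so its determinant has valuation at most `0`. The two determinants differ by the square of the
determinant of the change-of-basis matrix, whose valuation is therefore at most `d · dim A / 2`.
By the Smith normal form, the length of `Γ / Λ` is the order of that determinant, and order and
valuation are proportional with ratio `e`.
-/

namespace SymmetricOrder

section ValuationRing

variable {K : Type*} [Field K] (v : AddValuation K (WithTop ℚ))

theorem integers_ringOfIntegers : (AddValuation.toValuation v).Integers (ringOfIntegers v) where
  hom_inj := Subtype.coe_injective
  map_le_one := Subtype.prop
  exists_of_le_one _ hx := ⟨⟨_, hx⟩, rfl⟩

instance isFractionRing_ringOfIntegers : IsFractionRing (ringOfIntegers v) K :=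
  .of_field _ _ fun x => by
    obtain ⟨a, ha | ha⟩ := (integers_ringOfIntegers v).eq_algebraMap_or_inv_eq_algebraMap x
    · exact ⟨a, 1, by rw [ha, map_one, div_one]⟩
    · exact ⟨1, a, by rw [← ha, map_one, one_div, inv_inv]⟩

variable {v}

theorem isUnit_ringOfIntegers_iff {x : ringOfIntegers v} : IsUnit x ↔ v (x : K) = 0 :=
  (integers_ringOfIntegers v).isUnit_iff_valuation_eq_one

theorem associated_of_map_eq {x y : ringOfIntegers v} (h : v (x : K) = v (y : K)) :
    Associated x y :=
  associated_of_dvd_dvd ((integers_ringOfIntegers v).dvd_of_le h.le)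
    ((integers_ringOfIntegers v).dvd_of_le h.ge)

theorem irreducible_of_forall_associated_pow {R : Type*} [CommRing R] [IsDomain R] {ϖ : R}
    (hϖ₀ : ϖ ≠ 0) (hϖ : ¬ IsUnit ϖ) (h : ∀ x : R, x ≠ 0 → ∃ n : ℕ, Associated (ϖ ^ n) x) :
    Irreducible ϖ := by
  refine ⟨hϖ, fun a b hab => ?_⟩
  obtain ⟨m, hm⟩ := h a (by rintro rfl; exact hϖ₀ (by rw [hab, zero_mul]))
  obtain ⟨n, hn⟩ := h b (by rintro rfl; exact hϖ₀ (by rw [hab, mul_zero]))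
  have hmn : Associated (ϖ ^ (m + n)) (ϖ ^ 1) := by
    rw [pow_add, pow_one]
    nth_rw 3 [hab]
    exact hm.mul_mul hn
  have : m + n = 1 := le_antisymm ((pow_dvd_pow_iff hϖ₀ hϖ).mp hmn.dvd)
    ((pow_dvd_pow_iff hϖ₀ hϖ).mp hmn.symm.dvd)
  obtain rfl | rfl : m = 0 ∨ n = 0 := by omega
  · exact .inl (hm.isUnit (by simp))
  · exact .inr (hn.isUnit (by simp))

theorem IsDiscrete.exists_irreducible (hv : IsDiscrete v) :
    ∃ ϖ : ringOfIntegers v, Irreducible ϖ ∧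
      ∀ x : ringOfIntegers v, x ≠ 0 → ∃ n : ℕ, Associated (ϖ ^ n) x := by
  obtain ⟨ϖ, hϖ₀, hpos, hgen⟩ := hv
  have hassoc (x : ringOfIntegers v) (hx : x ≠ 0) :
      ∃ n : ℕ, Associated ((⟨ϖ, hpos.le⟩ : ringOfIntegers v) ^ n) x := by
    obtain ⟨n, hn⟩ := hgen x (by simpa using hx)
    obtain ⟨n, rfl | rfl⟩ := n.eq_nat_or_neg
    · exact ⟨n, associated_of_map_eq (by simpa using hn.symm)⟩
    · have hsum : v (x : K) + v (ϖ ^ n) = 0 := by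
        rw [hn, ← v.map_mul, zpow_neg, zpow_natCast, inv_mul_cancel₀ (pow_ne_zero _ hϖ₀), v.map_one]
      have hx₀ : v (x : K) = 0 := ((add_eq_zero_iff_of_nonneg x.2
        ((ringOfIntegers v).pow_mem (x := ϖ) hpos.le n)).mp hsum).1
      exact ⟨0, associated_of_map_eq (by simpa using hx₀.symm)⟩
  exact ⟨⟨ϖ, hpos.le⟩, irreducible_of_forall_associated_pow (by simpa [Subtype.ext_iff] using hϖ₀)
    (fun h => hpos.ne' (isUnit_ringOfIntegers_iff.mp h)) hassoc, hassoc⟩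

theorem IsDiscrete.isDiscreteValuationRing (hv : IsDiscrete v) :
    IsDiscreteValuationRing (ringOfIntegers v) :=
  let ⟨ϖ, hϖ, hassoc⟩ := hv.exists_irreducible
  .ofHasUnitMulPowIrreducibleFactorization ⟨ϖ, hϖ, hassoc _⟩

theorem IsDiscrete.exists_ord_eq_and_map_eq (hv : IsDiscrete v) :
    ∃ c : ℚ, ∀ a : ringOfIntegers v, a ≠ 0 →
      ∃ n : ℕ, Ring.ord (ringOfIntegers v) a = n ∧ v (a : K) = ((n * c : ℚ) : WithTop ℚ) := by
  have := hv.isDiscreteValuationRing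
  obtain ⟨ϖ, hϖ, hassoc⟩ := hv.exists_irreducible
  obtain ⟨c, hc⟩ := WithTop.ne_top_iff_exists.mp
    ((v.ne_top_iff (x := (ϖ : K))).mpr (by simpa using hϖ.ne_zero))
  refine ⟨c, fun a ha => ?_⟩
  obtain ⟨n, u, rfl⟩ := hassoc a ha
  refine ⟨n, ?_, ?_⟩
  · rw [Ring.ord_mul_of_isUnit_right u.isUnit,
      Ring.ord_pow (mem_nonZeroDivisors_of_ne_zero hϖ.ne_zero), Ring.ord_of_irreducible hϖ]
    simp
  · rw [Subring.coe_mul, v.map_mul, isUnit_ringOfIntegers_iff.mp u.isUnit, Subring.coe_pow,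
      v.map_pow, ← hc, add_zero, ← WithTop.coe_nsmul, nsmul_eq_mul]

theorem IsDiscretelyValuedExtension.map_prime {p : ℕ} [Fact p.Prime] [Algebra ℚ_[p] K]
    (hv : IsDiscretelyValuedExtension p v) : v (p : K) = 1 := by
  simpa using hv.extends_padic p (by exact_mod_cast (Fact.out : p.Prime).ne_zero)

end ValuationRing

section Determinants

variable {R Γ₀ : Type*} [CommRing R] [LinearOrderedAddCommMonoidWithTop Γ₀]
  (v : AddValuation R Γ₀)

theorem addValuation_prod {ι : Type*} (s : Finset ι) (f : ι → R) :
    v (∏ i ∈ s, f i) = ∑ i ∈ s, v (f i) :=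
  _root_.map_prod (AddValuation.toValuation v) f s

theorem card_nsmul_le_addValuation_det {n : Type*} [Fintype n] [DecidableEq n] {c : Γ₀}
    {M : Matrix n n R} (hM : ∀ i j, c ≤ v (M i j)) : Fintype.card n • c ≤ v M.det := by
  rw [Matrix.det_apply']
  refine v.map_le_sum fun σ _ => ?_
  have hsign : v ((Equiv.Perm.sign σ : ℤ) : R) = 0 := by
    rcases Int.units_eq_one_or (Equiv.Perm.sign σ) with h | h <;> simp [h, v.map_neg]
  rw [v.map_mul, hsign, zero_add, addValuation_prod]
  exact Finset.card_nsmul_le_sum _ _ _ fun i _ => hM _ _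

end Determinants

section Integrality

theorem isIntegral_of_mem_spectrum {R F B : Type*} [CommRing R] [Field F] [Ring B] [Algebra R F]
    [Algebra F B] [Algebra R B] [IsScalarTower R F B] {b : B} (hb : IsIntegral R b) {μ : F}
    (hμ : μ ∈ spectrum F b) : IsIntegral R μ := by
  obtain ⟨q, hq, hqb⟩ := hb
  refine ⟨q, hq, ?_⟩
  have : Nontrivial B := not_subsingleton_iff_nontrivial.mp fun _ => by
    simp [spectrum.of_subsingleton] at hμ
  have hmem := spectrum.subset_polynomial_aeval b (q.map (algebraMap R F)) ⟨μ, hμ, rfl⟩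
  rw [Polynomial.aeval_map_algebraMap, Polynomial.aeval_def, hqb, spectrum.zero_eq,
    Set.mem_singleton_iff] at hmem
  rwa [← Polynomial.eval_map]

theorem isIntegral_matrix_trace {R F n : Type*} [CommRing R] [Field F] [Algebra R F] [Fintype n]
    [DecidableEq n] {M : Matrix n n F} (hM : IsIntegral R M) : IsIntegral R M.trace := by
  let ι := IsScalarTower.toAlgHom R F (AlgebraicClosure F)
  rw [← isIntegral_algHom_iff ι ι.toRingHom.injective, AddMonoidHom.map_trace,
    Matrix.trace_eq_sum_roots_charpoly]
  refine IsIntegral.multiset_sum fun μ hμ => ?_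
  exact isIntegral_of_mem_spectrum (hM.map ι.mapMatrix)
    (Matrix.mem_spectrum_of_isRoot_charpoly (Polynomial.isRoot_of_mem_roots hμ))

end Integrality

section WeightedTraceForm

variable {F : Type*} [Field F] {B : Type*} [Ring B] [Algebra F B] {n : ℕ} {m : Fin n → ℕ}
  (φ : B ≃ₐ[F] ((i : Fin n) → Matrix (Fin (m i)) (Fin (m i)) F)) {u : Fin n → F}

theorem weightedTraceForm_apply (u : Fin n → F) (x y : B) :
    weightedTraceForm φ u x y = ∑ i, u i * (φ (x * y) i).trace :=
  rfl

theorem weightedTraceForm_isSymm (u : Fin n → F) : (weightedTraceForm φ u).IsSymm :=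
  ⟨fun x y => by simp [weightedTraceForm_apply, Matrix.trace_mul_comm (φ x _)]⟩

theorem weightedTraceForm_nondegenerate (hu : ∀ i, u i ≠ 0) :
    (weightedTraceForm φ u).Nondegenerate := by
  refine (weightedTraceForm_isSymm φ u).isRefl.nondegenerate_iff_separatingLeft.mpr fun x hx => ?_
  rw [← φ.map_eq_zero_iff]
  ext1 i
  rw [Matrix.ext_iff_trace_mul_right]
  intro M
  have hM := hx (φ.symm (Pi.single i M))
  rw [weightedTraceForm_apply, map_mul, φ.apply_symm_apply, Finset.sum_eq_single i] at hM
  · simpa [hu i] using hM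
  · intro j _ hj
    simp [Pi.single_eq_of_ne hj]
  · simp

variable {w : AddValuation F (WithTop ℚ)} {d : ℚ}

theorem le_map_weightedTraceForm (hu : ∀ i, ((-d : ℚ) : WithTop ℚ) ≤ w (u i)) {x y : B}
    (hxy : IsIntegral (ringOfIntegers w) (x * y)) :
    ((-d : ℚ) : WithTop ℚ) ≤ w (weightedTraceForm φ u x y) := by
  rw [weightedTraceForm_apply]
  refine w.map_le_sum fun i _ => ?_
  have htrace : IsIntegral (ringOfIntegers w) (φ (x * y) i).trace :=
    isIntegral_matrix_trace
      (hxy.map ((Pi.evalAlgHom F _ i).comp φ.toAlgHom |>.restrictScalars (ringOfIntegers w)))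
  have hnonneg : 0 ≤ w (φ (x * y) i).trace :=
    (integers_ringOfIntegers w).mem_of_integral htrace
  rw [w.map_mul]
  simpa using add_le_add (hu i) hnonneg

end WeightedTraceForm

section Duality

variable {R F V κ : Type*} [CommRing R] [Field F] [Algebra R F] [AddCommGroup V] [Module F V]
  [Module R V] [IsScalarTower R F V] [Fintype κ] [DecidableEq κ]

theorem exists_algebraMap_mul_det_toMatrix_eq_one {T : LinearMap.BilinForm F V}
    (hT : T.Nondegenerate) (b : Module.Basis κ F V)
    (hb : T.dualSubmodule (Submodule.span R (Set.range b)) ≤ Submodule.span R (Set.range b)) :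
    ∃ r : R, algebraMap R F r * (LinearMap.BilinForm.toMatrix b T).det = 1 := by
  rw [LinearMap.BilinForm.dualSubmodule_span_of_basis T hT] at hb
  have hrepr (i : κ) : ∃ c : κ → R, ∑ j, c j • b j = T.dualBasis hT b i :=
    (Submodule.mem_span_range_iff_exists_fun R).mp (hb (Submodule.subset_span ⟨i, rfl⟩))
  choose Q hQ using hrepr
  refine ⟨(Matrix.of Q).det, ?_⟩
  rw [RingHom.map_det, ← Matrix.det_mul, ← Matrix.det_one (n := κ) (R := F)]
  congr 1
  ext i j
  have hdual := LinearMap.BilinForm.apply_dualBasis_left hT b i j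
  rw [← hQ] at hdual
  simpa [Matrix.mul_apply, Matrix.one_apply, eq_comm, ← algebraMap_smul F] using hdual

end Duality

section Lattices

open Module

theorem ord_finsetProd {R ι : Type*} [CommRing R] [IsDomain R] (s : Finset ι) {a : ι → R}
    (ha : ∀ i ∈ s, a i ≠ 0) : Ring.ord R (∏ i ∈ s, a i) = ∑ i ∈ s, Ring.ord R (a i) := by
  induction s using Finset.cons_induction with
  | empty => simp
  | cons i s hi ih =>
    have hs : ∏ j ∈ s, a j ≠ 0 := Finset.prod_ne_zero_iff.mpr fun j hj => ha j (by simp [hj])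
    rw [Finset.prod_cons, Finset.sum_cons, Ring.ord_mul R (mem_nonZeroDivisors_of_ne_zero hs),
      ih fun j hj => ha j (by simp [hj])]

variable {R ι : Type*} [CommRing R] [IsDomain R] [IsPrincipalIdealRing R] [Fintype ι]
  [DecidableEq ι]

theorem length_quotient_eq_ord_det {M : Type*} [AddCommGroup M] [Module R M] (g : Basis ι R M)
    {N : Submodule R M} (b : Basis ι R N) :
    Module.length R (M ⧸ N) = Ring.ord R (LinearMap.toMatrix b g N.subtype).det := by
  have hrank : finrank R N = finrank R M := by
    rw [finrank_eq_card_basis b, finrank_eq_card_basis g]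
  let t := Submodule.smithNormalFormTopBasis g hrank
  let s := Submodule.smithNormalFormBotBasis g hrank
  let a := Submodule.smithNormalFormCoeffs g hrank
  have hdiag : LinearMap.toMatrix s t N.subtype = Matrix.diagonal a := by
    ext i j
    rcases eq_or_ne i j with rfl | hij
    · simp [LinearMap.toMatrix_apply, s, t, a]
    · simp [LinearMap.toMatrix_apply, s, t, hij]
  rw [← basis_toMatrix_mul_linearMap_toMatrix_mul_basis_toMatrix b s g t, hdiag,
    Matrix.det_mul, Matrix.det_mul, Matrix.det_diagonal, ← s.det_apply, ← g.det_apply,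
    Ring.ord_mul_of_isUnit_right (s.isUnit_det b),
    Ring.ord_mul_of_isUnit_left (g.isUnit_det t),
    ord_finsetProd _ fun i _ => Submodule.smithNormalFormCoeffs_ne_zero g hrank i,
    (N.quotientEquivPiSpan g hrank).length_eq, Module.length_pi_of_fintype]
  rfl

theorem exists_length_quotient_eq_ord {F V : Type*} [Field F] [Algebra R F]
    [Module.IsTorsionFree R F] [AddCommGroup V] [Module F V] [Module R V] [IsScalarTower R F V]
    (g b : Basis ι F V) {M N : Submodule R V} (hM : M = Submodule.span R (Set.range g))
    (hN : N = Submodule.span R (Set.range b)) (hNM : N ≤ M) :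
    ∃ r : R, algebraMap R F r = (g.toMatrix b).det ∧
      Module.length R (M ⧸ N.submoduleOf M) = Ring.ord R r := by
  subst hM hN
  let b' := (b.restrictScalars R).map (Submodule.submoduleOfEquivOfLe hNM).symm
  refine ⟨_, ?_, length_quotient_eq_ord_det (g.restrictScalars R) b'⟩
  rw [RingHom.map_det]
  congr 1
  ext i j
  have hb' : ((b' j : Submodule.span R (Set.range g)) : V) = b j := b.restrictScalars_apply R j
  simp [LinearMap.toMatrix_apply, Basis.toMatrix_apply, hb']

end Lattices

section Orders

open Module

variable {K : Type*} [Field K] {A : Type*} [Ring A] [Algebra K A]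

theorem IsOrder.exists_basis {O : Subring K} [IsFractionRing O K] {Λ : Subalgebra O A}
    (hΛ : IsOrder Λ) : ∃ b : Basis (Fin (finrank K A)) K A,
      Subalgebra.toSubmodule Λ = Submodule.span O (Set.range b) := by
  have : (Subalgebra.toSubmodule Λ).IsLattice K :=
    ⟨Module.Finite.iff_fg.mp hΛ.finite, hΛ.span_eq_top⟩
  have := hΛ.free
  have := hΛ.finite
  let β : Basis _ O (Subalgebra.toSubmodule Λ) := Free.chooseBasis O Λ
  let b := β.extendOfIsLattice K
  refine ⟨b.reindex (Fintype.equivFinOfCardEq (finrank_eq_card_basis b).symm), ?_⟩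
  have hb : ⇑b = (Subalgebra.toSubmodule Λ).subtype ∘ β := by
    ext i
    exact β.extendOfIsLattice_apply K i
  rw [Basis.range_reindex, hb, Set.range_comp, ← Submodule.map_span, β.span_eq,
    Submodule.map_subtype_top]

theorem IsOrder.isIntegral {O : Subring K} {Γ : Subalgebra O A} (hΓ : IsOrder Γ) {x : A}
    (hx : x ∈ Γ) : IsIntegral O x :=
  have := hΓ.finite
  (Algebra.IsIntegral.isIntegral (R := O) (⟨x, hx⟩ : Γ)).map Γ.val

end Orders

section Defect

theorem two_nsmul_map_det_add_map_det_toMatrix_le {F V κ : Type*} [Field F] [AddCommGroup V]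
    [Module F V] [Fintype κ] [DecidableEq κ] {w : AddValuation F (WithTop ℚ)}
    {T : LinearMap.BilinForm F V} (hT : T.Nondegenerate) (g b : Module.Basis κ F V)
    (hb : T.dualSubmodule (Submodule.span (ringOfIntegers w) (Set.range b)) ≤
      Submodule.span (ringOfIntegers w) (Set.range b)) :
    2 • w (g.toMatrix b).det + w (LinearMap.BilinForm.toMatrix g T).det ≤ 0 := by
  obtain ⟨r, hr⟩ := exists_algebraMap_mul_det_toMatrix_eq_one hT b hb
  have hsum : w (r : F) + (2 • w (g.toMatrix b).det +
      w (LinearMap.BilinForm.toMatrix g T).det) = 0 := by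
    rw [← w.map_one, ← hr, ← LinearMap.BilinForm.toMatrix_mul_basis_toMatrix g b T,
      Matrix.det_mul, Matrix.det_mul, Matrix.det_transpose, w.map_mul, w.map_mul, w.map_mul,
      two_nsmul, add_right_comm]
    rfl
  exact hsum ▸ le_add_of_nonneg_left r.2

theorem IsSplitDefect.two_nsmul_map_det_le {F : Type*} [Field F] {B : Type*} [Ring B]
    [Algebra F B] {w : AddValuation F (WithTop ℚ)} {Λ : Subalgebra (ringOfIntegers w) B} {d : ℚ}
    (hd : IsSplitDefect w Λ d) {κ : Type*} [Fintype κ] [DecidableEq κ] {g b : Module.Basis κ F B}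
    (hg : ∀ i j, IsIntegral (ringOfIntegers w) (g i * g j))
    (hb : Subalgebra.toSubmodule Λ = Submodule.span (ringOfIntegers w) (Set.range b)) :
    2 • w (g.toMatrix b).det ≤ ((Fintype.card κ * d : ℚ) : WithTop ℚ) := by
  obtain ⟨n, m, φ, u, -, hu, hdual, -, hmax⟩ := hd
  let T := weightedTraceForm φ u
  have hud (i : Fin n) : ((-d : ℚ) : WithTop ℚ) ≤ w (u i) := by
    obtain ⟨q, hq⟩ := WithTop.ne_top_iff_exists.mp ((w.ne_top_iff (x := u i)).mpr (hu i))
    have hqd : -q ≤ d := hmax ⟨i, by rw [neg_neg, hq]⟩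
    rw [← hq]
    exact WithTop.coe_le_coe.mpr (by linarith)
  have hdual' : T.dualSubmodule (Subalgebra.toSubmodule Λ) ≤ Subalgebra.toSubmodule Λ :=
    fun a ha => (hdual a).mpr fun x hx => by
      obtain ⟨r, hr⟩ := Submodule.mem_one.mp (ha x hx)
      exact hr ▸ r.2
  have hgram : Fintype.card κ • ((-d : ℚ) : WithTop ℚ) ≤
      w (LinearMap.BilinForm.toMatrix g T).det :=
    card_nsmul_le_addValuation_det w fun i j => by
      rw [LinearMap.BilinForm.toMatrix_apply]
      exact le_map_weightedTraceForm φ hud (hg i j)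
  have hle : 2 • w (g.toMatrix b).det + Fintype.card κ • ((-d : ℚ) : WithTop ℚ) ≤ 0 :=
    (add_le_add_right hgram _).trans <| two_nsmul_map_det_add_map_det_toMatrix_le
      (weightedTraceForm_nondegenerate φ hu) g b (hb ▸ hdual')
  calc 2 • w (g.toMatrix b).det
      = 2 • w (g.toMatrix b).det + Fintype.card κ • ((-d : ℚ) : WithTop ℚ) +
          ((Fintype.card κ * d : ℚ) : WithTop ℚ) := by
        rw [add_assoc, ← WithTop.coe_nsmul, ← WithTop.coe_add]
        simp
    _ ≤ ((Fintype.card κ * d : ℚ) : WithTop ℚ) := by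
        simpa using add_le_add_left hle ((Fintype.card κ * d : ℚ) : WithTop ℚ)

variable {K : Type*} [Field K] {v : AddValuation K (WithTop ℚ)} {A : Type*} [Ring A] [Algebra K A]
  {E : Type*} [Field E] [Algebra K E] {w : AddValuation E (WithTop ℚ)}

theorem mem_span_range_iff_forall_nonneg_repr {V κ : Type*} [AddCommGroup V] [Module K V]
    (b : Module.Basis κ K V) {x : V} :
    x ∈ Submodule.span (ringOfIntegers v) (Set.range b) ↔ ∀ i, 0 ≤ v (b.repr x i) := by
  rw [b.mem_span_iff_repr_mem (ringOfIntegers v)]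
  exact forall_congr' fun i => ⟨fun ⟨r, hr⟩ => hr ▸ r.2, fun h => ⟨⟨_, h⟩, rfl⟩⟩

theorem toSubmodule_generatedSubalgebra (hw : ∀ x : K, w (algebraMap K E x) = v x) {κ : Type*}
    {b : Module.Basis κ K A} {Λ : Subalgebra (ringOfIntegers v) A}
    (hb : Subalgebra.toSubmodule Λ = Submodule.span (ringOfIntegers v) (Set.range b)) :
    Subalgebra.toSubmodule (generatedSubalgebra (ringOfIntegers w)
      ((fun x : A => (1 : E) ⊗ₜ[K] x) '' (Λ : Set A))) =
        Submodule.span (ringOfIntegers w) (Set.range (Algebra.TensorProduct.basis E b)) := by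
  have hmem (x : A) : x ∈ Λ ↔ ∀ i, 0 ≤ v (b.repr x i) := by
    rw [← Subalgebra.mem_toSubmodule, hb, mem_span_range_iff_forall_nonneg_repr]
  let S : Submonoid (E ⊗[K] A) := Λ.toSubmonoid.map
    (Algebra.TensorProduct.includeRight : A →ₐ[K] E ⊗[K] A)
  have hS : (fun x : A => (1 : E) ⊗ₜ[K] x) '' (Λ : Set A) = (S : Set (E ⊗[K] A)) := rfl
  rw [generatedSubalgebra, Algebra.adjoin_eq_span, hS, Submonoid.closure_eq]
  refine le_antisymm (Submodule.span_le.mpr ?_) (Submodule.span_mono ?_)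
  · rintro _ ⟨x, hx, rfl⟩
    refine (mem_span_range_iff_forall_nonneg_repr _).mpr fun i => ?_
    simpa [hw] using (hmem x).mp hx i
  · rintro _ ⟨i, rfl⟩
    refine ⟨b i, ?_, (Algebra.TensorProduct.basis_apply b i).symm⟩
    exact (Subalgebra.mem_toSubmodule _).mp (hb ▸ Submodule.subset_span ⟨i, rfl⟩)

theorem isIntegral_one_tmul (hw : ∀ x : K, w (algebraMap K E x) = v x) {x : A}
    (hx : IsIntegral (ringOfIntegers v) x) :
    IsIntegral (ringOfIntegers w) ((1 : E) ⊗ₜ[K] x) := by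
  let ι : ringOfIntegers v →+* ringOfIntegers w :=
    (algebraMap K E).restrict _ _ fun y hy => le_of_le_of_eq hy (hw y).symm
  refine hx.map_of_comp_eq ι
    (Algebra.TensorProduct.includeRight : A →ₐ[K] E ⊗[K] A).toRingHom ?_
  ext y
  exact Algebra.TensorProduct.tmul_one_eq_one_tmul (y : K)

theorem IsDefect.two_nsmul_map_det_le {Λ : Subalgebra (ringOfIntegers v) A} {d : ℚ}
    (hd : IsDefect v Λ d) {κ : Type*} [Fintype κ] [DecidableEq κ] {g b : Module.Basis κ K A}
    (hg : ∀ i j, IsIntegral (ringOfIntegers v) (g i * g j))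
    (hb : Subalgebra.toSubmodule Λ = Submodule.span (ringOfIntegers v) (Set.range b)) :
    2 • v (g.toMatrix b).det ≤ ((Fintype.card κ * d : ℚ) : WithTop ℚ) := by
  obtain ⟨E, _, _, w, -, -, hw, hsplit⟩ := hd
  have hdet : ((Algebra.TensorProduct.basis E g).toMatrix (Algebra.TensorProduct.basis E b)).det =
      algebraMap K E (g.toMatrix b).det := by
    rw [RingHom.map_det]
    congr 1
    ext i j
    simp [Module.Basis.toMatrix_apply]
  rw [← hw, ← hdet]
  refine hsplit.two_nsmul_map_det_le (fun i j => ?_) (toSubmodule_generatedSubalgebra hw hb)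
  rw [Algebra.TensorProduct.basis_apply, Algebra.TensorProduct.basis_apply,
    Algebra.TensorProduct.tmul_mul_tmul, one_mul]
  exact isIntegral_one_tmul hw (hg i j)

end Defect

end SymmetricOrder

open SymmetricOrder in
theorem mainTheorem11_general {K : Type*} [Field K] {v : AddValuation K (WithTop ℚ)}
    (hv : IsDiscrete v) {x : ringOfIntegers v} (hx : v (x : K) = 1)
    {A : Type*} [Ring A] [Algebra K A] {Γ Λ : Subalgebra (ringOfIntegers v) A}
    (hΓ : IsOrder Γ) (hΛ : IsOrder Λ) (hΛΓ : Λ ≤ Γ) {d : ℚ} (hd : IsDefect v Λ d) :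
    ∃ l e : ℕ,
      Module.length (ringOfIntegers v)
        (Subalgebra.toSubmodule Γ ⧸
          (Subalgebra.toSubmodule Λ).submoduleOf (Subalgebra.toSubmodule Γ)) = l ∧
      Module.length (ringOfIntegers v) (ringOfIntegers v ⧸ Ideal.span {x}) = e ∧
      (l : ℚ) ≤ 1 / 2 * e * d * Module.finrank K A := by
  have := hv.isDiscreteValuationRing
  obtain ⟨c, hc⟩ := hv.exists_ord_eq_and_map_eq
  obtain ⟨g, hg⟩ := hΓ.exists_basis
  obtain ⟨b, hb⟩ := hΛ.exists_basis
  obtain ⟨r, (hr : (r : K) = _), hlength⟩ := exists_length_quotient_eq_ord g b hg hb hΛΓ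
  have hr₀ : r ≠ 0 := by
    rintro rfl
    exact (g.isUnit_det b).ne_zero (by rw [Module.Basis.det_apply, ← hr, ZeroMemClass.coe_zero])
  obtain ⟨l, hl, hvr⟩ := hc r hr₀
  obtain ⟨e, he, hvx⟩ := hc x (by rintro rfl; simp at hx)
  refine ⟨l, e, hlength.trans hl, he, ?_⟩
  have hgΓ (i) : g i ∈ Γ :=
    (Subalgebra.mem_toSubmodule _).mp (hg ▸ Submodule.subset_span ⟨i, rfl⟩)
  have hec : e * c = 1 := WithTop.coe_injective (hvx.symm.trans hx)
  have hlc : 2 * (l * c) ≤ Module.finrank K A * d := by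
    have h := hd.two_nsmul_map_det_le (fun i j => hΓ.isIntegral (Γ.mul_mem (hgΓ i) (hgΓ j))) hb
    rw [← hr, hvr, ← WithTop.coe_nsmul, WithTop.coe_le_coe] at h
    simpa using h
  calc (l : ℚ) = e / 2 * (2 * (l * c)) := by linear_combination -(l : ℚ) * hec
    _ ≤ e / 2 * (Module.finrank K A * d) := by gcongr
    _ = 1 / 2 * e * d * Module.finrank K A := by ring

theorem mainTheorem11 (p : ℕ) [Fact p.Prime]
    {K : Type*} [Field K] [Algebra ℚ_[p] K] (v : AddValuation K (WithTop ℚ))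
    (hv : SymmetricOrder.IsDiscretelyValuedExtension p v)
    {A : Type*} [Ring A] [Algebra K A] [FiniteDimensional K A] [IsSemisimpleRing A]
    (Γ : Subalgebra (SymmetricOrder.ringOfIntegers v) A) (hΓ : SymmetricOrder.IsMaximalOrder Γ)
    (Λ : Subalgebra (SymmetricOrder.ringOfIntegers v) A) (hΛΓ : Λ ≤ Γ)
    (hΛ : SymmetricOrder.IsSymmetricOrder Λ)
    (d : ℚ) (hd : SymmetricOrder.IsDefect v Λ d) :
    ∃ l e : ℕ,
      Module.length (SymmetricOrder.ringOfIntegers v)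
        (Subalgebra.toSubmodule Γ ⧸
          (Subalgebra.toSubmodule Λ).submoduleOf (Subalgebra.toSubmodule Γ)) = l ∧
      Module.length (SymmetricOrder.ringOfIntegers v)
        (SymmetricOrder.ringOfIntegers v ⧸
          Ideal.span {(p : SymmetricOrder.ringOfIntegers v)}) = e ∧
      (l : ℚ) ≤ 1 / 2 * e * d * Module.finrank K A := by
  exact mainTheorem11_general hv.discrete hv.map_prime hΓ.prop hΛ.1 hΛΓ hd
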